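/- Let $G$ be a (finite-dimensional, real, smooth) Lie group with $\mathfrak g=T_eG$, and let $\Omega^0(G,\mathfrak g)$ be the space of smooth maps $G\to\mathfrak g$. Let $[\cdot,\cdot]_{\mathfrak g}$ be the Lie bracket on $\mathfrak g$ obtained by identifying $\mathfrak g$ with the *right*-invariant vector fields on $G$ and their Jacobi--Lie bracket $[\![X,Y]\!]\phi=X(Y\phi)-Y(X\phi)$; it is the negative of the bracket obtained from left-invariant vector fields. For $x,y\in\Omega^0(G,\mathfrak g)$ put $[x,y](g)=[x(g),y(g)]_{\mathfrak g}$. Let $\rho_*(x)$ and $\lambda_*(x)$ be the vector fields $$\rho_*(x)(g)=\tfrac{\partial}{\partial t}\big|_{t=0}\,g\exp(t\,x(g))=T_eL_g\,x(g),\qquad \lambda_*(x)(g)=\tfrac{\partial}{\partial t}\big|_{t=0}\exp(t\,x(g))\,g=T_eR_g\,x(g);$$ thus $\rho_*$ is the inverse of the left Maurer--Cartan form $\omega_g=TL_{g^{-1}}$, and $\lambda_*$ is the inverse of the right one. Define $x\mathbin{\tilde\rhd}y:=\rho_*(x)(y)$ and $x\rhd y:=\lambda_*(x)(y)$ (Lie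 derivatives of the $\mathfrak g$-valued function $y$ along these vector fields). A post-Lie algebra $\{A,[\cdot,\cdot],\rhd\}$ is a Lie algebra $\{A,[\cdot,\cdot]\}$ with a bilinear product $\rhd$ on $A$ such that $x\rhd[y,z]=[x\rhd y,z]+[y,x\rhd z]$ and $[x,y]\rhd z=a(x,y,z)-a(y,x,z)$, where $a(x,y,z)=x\rhd(y\rhd z)-(x\rhd y)\rhd z$. Then: 1. $\{\Omega^0(G,\mathfrak g),-[\cdot,\cdot],\tilde\rhd\}$ is a post-Lie algebra over $\mathbb R$. 2. The connection $\tilde\rhd$ of the left trivialization is related to the connection $\rhd$ of the right trivialization by $x\mathbin{\tilde\rhd}y=x\rhd y+[x,y]$, where $\rhd$ is transported to the left trivialization. That is, let $\Phi\colon\Omega^0(G,\mathfrak g)\to\Omega^0(G,\mathfrak g)$, $\Phi(\tilde x)=\omega(\lambda_*(\tilde x))$, be the bijection that sends the right-trivialized representative $\tilde x$ of a vector field to its left-trivialized representative, so that $\rho_*(\Phi(\tilde x))=\lambda_*(\tilde x)$. Then for all $x,y\in\Omega^0(G,\mathfrak g)$, $$x\mathbin{\tilde\rhd}y=\Phi\bigl(\Phi^{-1}(x)\rhd\Phi^{-1}(y)\bigr)+[x,y].$$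 -/

import Mathlib

open scoped Manifold ContDiff

/-- A post-Lie algebra `{A, [·,·], ▷}` over a field `k`: a Lie bracket `br` on `A` together with
a bilinear product `tr` such that `x ▷ ·` is a derivation of the bracket and
`[x,y] ▷ z = a(x,y,z) - a(y,x,z)`, where `a(x,y,z) = x ▷ (y ▷ z) - (x ▷ y) ▷ z`. -/
structure IsPostLieAlgebra (k : Type*) [Field k] {A : Type*} [AddCommGroup A] [Module k A]
    (br tr : A → A → A) : Prop where
  br_add_left : ∀ x y z, br (x + y) z = br x z + br y z
  br_smul_left : ∀ (c : k) x y, br (c • x) y = c • br x y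
  br_add_right : ∀ x y z, br x (y + z) = br x y + br x z
  br_smul_right : ∀ (c : k) x y, br x (c • y) = c • br x y
  br_self : ∀ x, br x x = 0
  br_jacobi : ∀ x y z, br (br x y) z + br (br y z) x + br (br z x) y = 0
  tr_add_left : ∀ x y z, tr (x + y) z = tr x z + tr y z
  tr_smul_left : ∀ (c : k) x y, tr (c • x) y = c • tr x y
  tr_add_right : ∀ x y z, tr x (y + z) = tr x y + tr x z
  tr_smul_right : ∀ (c : k) x y, tr x (c • y) = c • tr x y
  tr_br : ∀ x y z, tr x (br y z) = br (tr x y) z + br y (tr x z)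
  br_tr : ∀ x y z, tr (br x y) z =
    (tr x (tr y z) - tr (tr x y) z) - (tr y (tr x z) - tr (tr y x) z)

namespace LieFun

noncomputable section

variable {E : Type*} [NormedAddCommGroup E] [NormedSpace ℝ E]
  {H : Type*} [TopologicalSpace H] (I : ModelWithCorners ℝ E H)

/-- `Ω⁰(G, 𝔤)`: the smooth maps `G → 𝔤`. The Lie algebra `𝔤 = GroupLieAlgebra I G = T_e G` is, as
a vector space, the model space `E` (every tangent space is, by definition, in Mathlib). -/
abbrev Omega0 (G : Type*) [TopologicalSpace G] [ChartedSpace H G] : Type _ :=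
  C^∞⟮I, G; 𝓘(ℝ, E), E⟯

variable {G : Type*} [TopologicalSpace G] [ChartedSpace H G]

theorem mk_congr {a b : G} (h : a = b) (v : E) :
    (⟨a, v⟩ : TangentBundle I G) = ⟨b, v⟩ := by
  subst h; rfl

theorem mfderiv_comp_eq {f k : G → G} {a b : G} (hb : f a = b) (hk : MDifferentiableAt I I k b)
    (hf : MDifferentiableAt I I f a) (v : E) :
    (mfderiv I I k b (mfderiv I I f a v : E) : E) = mfderiv I I (k ∘ f) a v := by
  subst hb
  exact (mfderiv_comp_apply (I := I) (I' := I) (I'' := I) a hk hf v).symm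

theorem mfderiv_comp_eq_self {f k : G → G} {a b : G} (hb : f a = b)
    (hk : MDifferentiableAt I I k b) (hf : MDifferentiableAt I I f a) (hid : k ∘ f = id) (v : E) :
    (mfderiv I I k b (mfderiv I I f a v : E) : E) = v := by
  rw [mfderiv_comp_eq I hb hk hf, hid, mfderiv_id]
  rfl

variable [Group G]

/-- `T_e L_g : 𝔤 → T_g G`, the differential at the identity of `h ↦ g h`. Its value at `v` is
the infinitesimal right action `d/dt|_{t=0} g exp(t v)`. -/
def tangentLeft (g : G) (v : GroupLieAlgebra I G) : TangentSpace I g :=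
  mfderiv I I (fun h : G => g * h) 1 v

/-- `T_e R_g : 𝔤 → T_g G`, the differential at the identity of `h ↦ h g`. Its value at `v` is
the infinitesimal left action `d/dt|_{t=0} exp(t v) g`. -/
def tangentRight (g : G) (v : GroupLieAlgebra I G) : TangentSpace I g :=
  mfderiv I I (fun h : G => h * g) 1 v

/-- The left Maurer–Cartan form `ω_g : T_g G → 𝔤`, `ω_g(w) = T L_{g⁻¹} w`. -/
def leftMC (g : G) (w : TangentSpace I g) : GroupLieAlgebra I G :=
  mfderiv I I (fun h : G => g⁻¹ * h) g w

/-- The right Maurer–Cartan form `T_g G → 𝔤`, `w ↦ T R_{g⁻¹} w`. -/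
def rightMC (g : G) (w : TangentSpace I g) : GroupLieAlgebra I G :=
  mfderiv I I (fun h : G => h * g⁻¹) g w

/-- The vector field `ρ_*(x)` on `G`: `ρ_*(x)(g) = T L_g (x(g)) = d/dt|_{t=0} g exp(t x(g))`. -/
def rhoStar (x : Omega0 I G) (g : G) : TangentSpace I g := tangentLeft I g (x g)

/-- The vector field `λ_*(x)` on `G`: `λ_*(x)(g) = T R_g (x(g)) = d/dt|_{t=0} exp(t x(g)) g`. -/
def lambdaStar (x : Omega0 I G) (g : G) : TangentSpace I g := tangentRight I g (x g)

/-- The Lie bracket of `𝔤`, in the convention in which `𝔤 = T_e G` is identified with the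
right-invariant vector fields: the value at the identity of the Jacobi–Lie bracket
(`⟦X,Y⟧φ = X(Yφ) - Y(Xφ)`) of the right-invariant fields generated by `v` and `w`. -/
def rightBracket (v w : GroupLieAlgebra I G) : GroupLieAlgebra I G :=
  VectorField.mlieBracket I (fun g => tangentRight I g v) (fun g => tangentRight I g w) (1 : G)

theorem rightField_add (v w : E) : (fun g : G => tangentRight I g (v + w)) =
    (fun g : G => tangentRight I g v) + fun g : G => tangentRight I g w := by
  ext g; exact (mfderiv I I (fun h : G => h * g) 1).map_add v w

theorem rightField_smul (c : ℝ) (v : E) : (fun g : G => tangentRight I g (c • v)) =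
    c • (fun g : G => tangentRight I g v) := by
  ext g; exact (mfderiv I I (fun h : G => h * g) 1).map_smul c v

section Smoothness

variable [LieGroup I ∞ G]

theorem contMDiff_mk_one {f : G → E} :
    ContMDiff I I.tangent ∞ (fun g => (⟨1, f g⟩ : TangentBundle I G)) ↔
      ContMDiff I 𝓘(ℝ, E) ∞ f := by
  have key : ∀ g : G, ((trivializationAt E (TangentSpace I) (1 : G))
      (⟨1, f g⟩ : TangentBundle I G)).2 = f g := by
    intro g
    exact (tangentBundleCore I G).coordChange_self (achart H (1 : G)) 1 (mem_chart_source H 1) (f g)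
  refine forall_congr' fun g => ?_
  rw [Bundle.contMDiffAt_totalSpace]
  simp only [key]
  exact ⟨fun h => h.2, fun h => ⟨contMDiffAt_const, h⟩⟩

/-- Smooth dependence on `g` of the differential at `h = 1` of `h ↦ F (g, h)`. -/
theorem contMDiff_mfderiv_snd {F : G × G → G} (hF : ContMDiff (I.prod I) I ∞ F)
    {x : G → E} (hx : ContMDiff I 𝓘(ℝ, E) ∞ x) :
    ContMDiff I I.tangent ∞ (fun g => (⟨F (g, 1), mfderiv I I (fun h : G => F (g, h)) 1 (x g)⟩ :
      TangentBundle I G)) := by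
  let F₁ : G → TangentBundle I G × TangentBundle I G := fun g => (⟨g, 0⟩, ⟨1, x g⟩)
  have S₁ : ContMDiff I (I.tangent.prod I.tangent) ∞ F₁ :=
    (Bundle.contMDiff_zeroSection ℝ _).prodMk ((contMDiff_mk_one I).2 hx)
  have S₂ : ContMDiff (I.tangent.prod I.tangent) (I.prod I).tangent ∞
      (equivTangentBundleProd I G I G).symm := contMDiff_equivTangentBundleProd_symm
  have S₃ : ContMDiff (I.prod I).tangent I.tangent ∞ (tangentMap (I.prod I) I F) :=
    hF.contMDiff_tangentMap (m := ∞) (by simp)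
  convert! (S₃.comp S₂).comp S₁ with g
  simp only [Function.comp_apply, tangentMap, F₁]
  rw [mfderiv_prod_eq_add_apply (hF.mdifferentiable (by simp) _)]
  simp only [equivTangentBundleProd, Equiv.coe_fn_symm_mk]
  have h0 : ∀ L : E →L[ℝ] E, ∀ w : E, w = L 0 + w := fun L w => by simp
  exact h0 _ _

theorem contMDiff_tangentLeft {x : G → E} (hx : ContMDiff I 𝓘(ℝ, E) ∞ x) :
    ContMDiff I I.tangent ∞ (fun g => (⟨g, tangentLeft I g (x g)⟩ : TangentBundle I G)) :=
  (contMDiff_mfderiv_snd I (contMDiff_mul I ∞ (G := G)) hx).congr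
    fun g => mk_congr I (mul_one g).symm _

theorem contMDiff_tangentRight {x : G → E} (hx : ContMDiff I 𝓘(ℝ, E) ∞ x) :
    ContMDiff I I.tangent ∞ (fun g => (⟨g, tangentRight I g (x g)⟩ : TangentBundle I G)) :=
  (contMDiff_mfderiv_snd I (F := fun p : G × G => p.2 * p.1)
    (contMDiff_snd.mul contMDiff_fst) hx).congr fun g => mk_congr I (one_mul g).symm _

theorem mdiff_mulLeft (a b : G) : MDifferentiableAt I I (fun h : G => a * h) b :=
  (contMDiff_mul_left (I := I) (n := ∞)).mdifferentiable (by simp) b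

theorem mdiff_mulRight (a b : G) : MDifferentiableAt I I (fun h : G => h * a) b :=
  (contMDiff_mul_right (I := I) (n := ∞)).mdifferentiable (by simp) b

/-- `d/dt|_{t=0} g γ(t) = T_e L_g (γ'(0))` for every curve `γ` with `γ(0) = e`, such as
`γ(t) = exp(t v)`. -/
theorem velocity_mul_left (g : G) {γ : ℝ → G} (h0 : γ 0 = 1)
    (hγ : MDifferentiableAt 𝓘(ℝ, ℝ) I γ 0) :
    (mfderiv 𝓘(ℝ, ℝ) I (fun t => g * γ t) 0 (1 : ℝ) : E) =
      tangentLeft I g (mfderiv 𝓘(ℝ, ℝ) I γ 0 (1 : ℝ) : E) := by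
  unfold tangentLeft
  rw [← h0]
  exact mfderiv_comp_apply (I := 𝓘(ℝ, ℝ)) (I' := I) (I'' := I) 0
    (g := fun h : G => g * h) (mdiff_mulLeft I _ _) hγ (1 : ℝ)

/-- `d/dt|_{t=0} γ(t) g = T_e R_g (γ'(0))` for every curve `γ` with `γ(0) = e`, such as
`γ(t) = exp(t v)`. -/
theorem velocity_mul_right (g : G) {γ : ℝ → G} (h0 : γ 0 = 1)
    (hγ : MDifferentiableAt 𝓘(ℝ, ℝ) I γ 0) :
    (mfderiv 𝓘(ℝ, ℝ) I (fun t => γ t * g) 0 (1 : ℝ) : E) =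
      tangentRight I g (mfderiv 𝓘(ℝ, ℝ) I γ 0 (1 : ℝ) : E) := by
  unfold tangentRight
  rw [← h0]
  exact mfderiv_comp_apply (I := 𝓘(ℝ, ℝ)) (I' := I) (I'' := I) 0
    (g := fun h : G => h * g) (mdiff_mulRight I _ _) hγ (1 : ℝ)

theorem leftMC_tangentRight (g : G) (v : E) :
    leftMC I g (tangentRight I g v) = mfderiv I I (fun h : G => g⁻¹ * (h * g)) 1 v :=
  mfderiv_comp_eq I (f := fun h => h * g) (one_mul g) (mdiff_mulLeft I _ _) (mdiff_mulRight I _ _) v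

theorem rightMC_tangentLeft (g : G) (v : E) :
    rightMC I g (tangentLeft I g v) = mfderiv I I (fun h : G => (g * h) * g⁻¹) 1 v :=
  mfderiv_comp_eq I (mul_one g) (mdiff_mulRight I _ _) (mdiff_mulLeft I _ _) v

theorem leftMC_tangentLeft (g : G) (v : E) : leftMC I g (tangentLeft I g v) = v :=
  mfderiv_comp_eq_self I (mul_one g) (mdiff_mulLeft I _ _) (mdiff_mulLeft I _ _)
    (by ext; simp) v

theorem tangentLeft_leftMC (g : G) (w : E) : tangentLeft I g (leftMC I g w) = w :=
  mfderiv_comp_eq_self I (inv_mul_cancel g) (mdiff_mulLeft I _ _) (mdiff_mulLeft I _ _)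
    (by ext; simp) w

theorem rightMC_tangentRight (g : G) (v : E) : rightMC I g (tangentRight I g v) = v :=
  mfderiv_comp_eq_self I (f := fun h => h * g) (one_mul g) (mdiff_mulRight I _ _) (mdiff_mulRight I _ _)
    (by ext; simp) v

theorem tangentRight_rightMC (g : G) (w : E) : tangentRight I g (rightMC I g w) = w :=
  mfderiv_comp_eq_self I (f := fun h => h * g⁻¹) (mul_inv_cancel g) (mdiff_mulRight I _ _)
    (mdiff_mulRight I _ _) (by ext; simp) w

theorem contMDiff_leftMC_tangentRight {x : G → E} (hx : ContMDiff I 𝓘(ℝ, E) ∞ x) :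
    ContMDiff I 𝓘(ℝ, E) ∞ (M' := E) (fun g => leftMC I g (tangentRight I g (x g))) := by
  refine (contMDiff_mk_one I).1 ?_
  refine (contMDiff_mfderiv_snd I (F := fun p : G × G => p.1⁻¹ * (p.2 * p.1))
    ((contMDiff_fst.inv).mul (contMDiff_snd.mul contMDiff_fst)) hx).congr fun g => ?_
  rw [leftMC_tangentRight]
  exact mk_congr I (by simp) _

theorem contMDiff_rightMC_tangentLeft {x : G → E} (hx : ContMDiff I 𝓘(ℝ, E) ∞ x) :
    ContMDiff I 𝓘(ℝ, E) ∞ (M' := E) (fun g => rightMC I g (tangentLeft I g (x g))) := by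
  refine (contMDiff_mk_one I).1 ?_
  refine (contMDiff_mfderiv_snd I (F := fun p : G × G => (p.1 * p.2) * p.1⁻¹)
    ((contMDiff_fst.mul contMDiff_snd).mul contMDiff_fst.inv) hx).congr fun g => ?_
  rw [rightMC_tangentLeft]
  exact mk_congr I (by simp) _

/-- The Lie derivative of a smooth function along a smooth vector field is smooth. -/
theorem contMDiff_lieDeriv {V : ∀ g : G, TangentSpace I g}
    (hV : ContMDiff I I.tangent ∞ (fun g => (⟨g, V g⟩ : TangentBundle I G)))
    (y : Omega0 I G) :
    ContMDiff I 𝓘(ℝ, E) ∞ (fun g => (mfderiv I 𝓘(ℝ, E) y g (V g) : E)) :=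
  (contMDiff_snd_tangentBundle_modelSpace E 𝓘(ℝ, E)).comp
    ((y.contMDiff.contMDiff_tangentMap (m := ∞) (by simp)).comp hV)

theorem mdiff_rightField (v : E) (g : G) : MDifferentiableAt I I.tangent
    (fun g => (⟨g, tangentRight I g v⟩ : TangentBundle I G)) g :=
  (contMDiff_tangentRight I (x := fun _ => v) contMDiff_const).mdifferentiable (by simp) g

variable (G) in
/-- `rightBracket` as a bilinear map. -/
def rightBracketBilin [CompleteSpace E] : E →ₗ[ℝ] E →ₗ[ℝ] E :=
  have : IsManifold I 2 G := IsManifold.of_le (n := ∞) (by norm_cast)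
  LinearMap.mk₂ ℝ (fun v w => (rightBracket I (G := G) v w : E))
    (fun u v w => by
      simp only [rightBracket, rightField_add]
      exact VectorField.mlieBracket_add_left (mdiff_rightField I _ _) (mdiff_rightField I _ _))
    (fun c v w => by
      simp only [rightBracket, rightField_smul]
      exact VectorField.mlieBracket_const_smul_left (mdiff_rightField I _ _))
    (fun u v w => by
      simp only [rightBracket, rightField_add]
      exact VectorField.mlieBracket_add_right (mdiff_rightField I _ _) (mdiff_rightField I _ _))
    (fun c v w => by
      simp only [rightBracket, rightField_smul]
      exact VectorField.mlieBracket_const_smul_right (mdiff_rightField I _ _))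

theorem contMDiff_rightBracket [FiniteDimensional ℝ E] (x y : Omega0 I G) :
    ContMDiff I 𝓘(ℝ, E) ∞ (M' := E) (fun g => rightBracket I (G := G) (x g) (y g)) := by
  have : CompleteSpace E := FiniteDimensional.complete ℝ E
  let B : E →L[ℝ] E →L[ℝ] E :=
    (LinearMap.toContinuousLinearMap.toLinearMap ∘ₗ rightBracketBilin I G).toContinuousLinearMap
  have h : ContMDiff I 𝓘(ℝ, E) ∞ (fun g => B (x g) (y g)) :=
    (B.contMDiff.comp x.contMDiff).clm_apply y.contMDiff
  exact h

/-- The product `x ▷̃ y = ρ_*(x)(y)`, the Lie derivative of `y` along `ρ_*(x)`. -/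
def leftConn (x y : Omega0 I G) : Omega0 I G :=
  ⟨fun g => (mfderiv I 𝓘(ℝ, E) y g (rhoStar I x g) : E),
    contMDiff_lieDeriv I (contMDiff_tangentLeft I x.contMDiff) y⟩

/-- The product `x ▷ y = λ_*(x)(y)`, the Lie derivative of `y` along `λ_*(x)`. -/
def rightConn (x y : Omega0 I G) : Omega0 I G :=
  ⟨fun g => (mfderiv I 𝓘(ℝ, E) y g (lambdaStar I x g) : E),
    contMDiff_lieDeriv I (contMDiff_tangentRight I x.contMDiff) y⟩

/-- The pointwise bracket `[x,y](g) = [x(g), y(g)]_𝔤`. -/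
def bracket [FiniteDimensional ℝ E] (x y : Omega0 I G) : Omega0 I G :=
  ⟨fun g => (rightBracket I (G := G) (x g) (y g) : E), contMDiff_rightBracket I x y⟩

variable (G) in
/-- The correspondence between right and left trivializations of vector fields: it sends `x'` to
the function `x = ω(λ_*(x'))`, i.e. to the unique `x` with `ρ_*(x) = λ_*(x')`
(so `x(g) = Ad_{g⁻¹} x'(g)`). -/
def rightToLeft : Omega0 I G ≃ Omega0 I G where
  toFun x := ⟨fun g => (leftMC I g (lambdaStar I x g) : E),
    contMDiff_leftMC_tangentRight I x.contMDiff⟩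
  invFun x := ⟨fun g => (rightMC I g (rhoStar I x g) : E),
    contMDiff_rightMC_tangentLeft I x.contMDiff⟩
  left_inv x := by
    ext g
    exact (congrArg (rightMC I g) (tangentLeft_leftMC I g _)).trans
      (rightMC_tangentRight I g (x g))
  right_inv x := by
    ext g
    exact (congrArg (leftMC I g) (tangentRight_rightMC I g _)).trans
      (leftMC_tangentLeft I g (x g))

end Smoothness

end

end LieFun

/-! In the left trivialization the constant maps are the left-invariant fields, and the product is
(x ▷̃ z)(g) = Dz(g)(x(g)) with Dz(g) = dz ∘ T_eL_g (`trivDeriv`). By the Leibniz rule the associator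
a(x,y,z)(g) is the derivative of Dz along T_eL_g x(g), applied to y(g). It is pointwise in x and y,
so its antisymmetrization may be computed on left-invariant fields. There it is a commutator of Lie
derivatives, hence Dz of the left-invariant bracket (`associator_apply`, `vderiv_trivDeriv_sub`).
The derivation law holds because the bracket is a fixed bilinear map on 𝔤.

For the comparison of connections, Φ⁻¹(y)(g) = Ad_g y(g). Differentiating this along T_eL_g x(g)
gives Ad_g of x ▷̃ y plus the left-invariant bracket of x and y, since d Ad = Ad ∘ ad
(`vderiv_adjoint`). Applying Ad_{g⁻¹} gives the formula, with the sign fixed by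
`rightBracket_eq_neg`.

Both that sign and d Ad at the identity come from the group law in a chart at e: the derivatives
there of left- and right-invariant fields are mixed second derivatives of multiplication, and
symmetry exchanges them (`fderiv_chartField_swap`). -/

namespace LieFun

open VectorField Filter Topology

/-! ### Vector fields and Lie brackets in a chart -/

section Chart

variable {E : Type*} [NormedAddCommGroup E] [NormedSpace ℝ E]
  {H : Type*} [TopologicalSpace H] (I : ModelWithCorners ℝ E H)
  {M : Type*} [TopologicalSpace M] [ChartedSpace H M]
  {F : Type*} [NormedAddCommGroup F] [NormedSpace ℝ F]

/-- The differential of a vector-valued function, as a linear map on the model space. -/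
noncomputable def vderiv (f : M → F) (x : M) : E →L[ℝ] F := mfderiv I 𝓘(ℝ, F) f x

/-- The representative of a vector field in the chart at `x₀`. -/
noncomputable def chartField (V : M → E) (x₀ : M) (y : E) : E :=
  vderiv I (extChartAt I x₀) ((extChartAt I x₀).symm y) (V ((extChartAt I x₀).symm y))

theorem vderiv_extChartAt_self [IsManifold I 1 M] (x : M) :
    vderiv I (extChartAt I x) x = .id ℝ E :=
  mfderiv_extChartAt_self

theorem chartField_self [IsManifold I 1 M] (V : M → E) (x₀ : M) :
    chartField I V x₀ (extChartAt I x₀ x₀) = V x₀ := by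
  unfold chartField
  rw [extChartAt_to_inv, vderiv_extChartAt_self]
  rfl

variable [I.Boundaryless]

theorem vderiv_eq_fderiv_comp_symm {k : M → F} {x : M} (hk : MDifferentiableAt I 𝓘(ℝ, F) k x) :
    vderiv I k x = fderiv ℝ (k ∘ (extChartAt I x).symm) (extChartAt I x x) := by
  unfold vderiv
  rw [hk.mfderiv, I.range_eq_univ, fderivWithin_univ]
  rfl

theorem differentiableAt_comp_symm {k : M → F} {x : M} (hk : MDifferentiableAt I 𝓘(ℝ, F) k x) :
    DifferentiableAt ℝ (k ∘ (extChartAt I x).symm) (extChartAt I x x) := by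
  have h := hk.hasMFDerivAt.2.differentiableWithinAt
  rw [I.range_eq_univ] at h
  exact differentiableWithinAt_univ.1 h

variable [IsManifold I 1 M]

/-- On the chart target the differentials of the chart and of its inverse are mutually inverse, so
pulling back by the inverse chart is pushing forward by the chart. -/
theorem chartField_eventuallyEq (V : M → E) (x₀ : M) :
    (fun y => (mpullbackWithin 𝓘(ℝ, E) I (extChartAt I x₀).symm V (Set.range I) y : E))
      =ᶠ[𝓝 (extChartAt I x₀ x₀)] chartField I V x₀ := by
  filter_upwards [extChartAt_target_mem_nhds (I := I) x₀] with y hy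
  exact congrArg (fun L : E →L[ℝ] E => L (V ((extChartAt I x₀).symm y)))
    (ContinuousLinearMap.inverse_eq
      (mfderivWithin_extChartAt_symm_comp_mfderiv_extChartAt hy)
      (mfderiv_extChartAt_comp_mfderivWithin_extChartAt_symm hy))

/-- The chart at x₀ has identity differential at x₀, so no transport factor remains. -/
theorem mlieBracket_eq_lieBracket_chartField (V W : M → E) (x₀ : M) :
    (mlieBracket I V W x₀ : E) =
      lieBracket ℝ (chartField I V x₀) (chartField I W x₀) (extChartAt I x₀ x₀) := by
  have h1 : (vderiv I (extChartAt I x₀) x₀).inverse = .id ℝ E := by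
    rw [vderiv_extChartAt_self, ContinuousLinearMap.inverse_id]
  have h2 := (chartField_eventuallyEq I V x₀).lieBracket_vectorField_eq (𝕜 := ℝ)
    (chartField_eventuallyEq I W x₀)
  have h3 (A B : E → E) (y : E) : lieBracketWithin ℝ A B
      ((extChartAt I x₀).symm ⁻¹' Set.univ ∩ Set.range I) y = lieBracket ℝ A B y := by
    rw [I.range_eq_univ, Set.preimage_univ, Set.univ_inter, lieBracketWithin_univ]
  exact (congrArg (fun L : E →L[ℝ] E => L _) h1).trans ((h3 _ _ _).trans h2)

theorem vderiv_symm_apply {f : M → F} (V : M → E) (x₀ : M) {y : E}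
    (hy : y ∈ (extChartAt I x₀).target)
    (hf : MDifferentiableAt I 𝓘(ℝ, F) f ((extChartAt I x₀).symm y)) :
    vderiv I f ((extChartAt I x₀).symm y) (V ((extChartAt I x₀).symm y)) =
      fderiv ℝ (f ∘ (extChartAt I x₀).symm) y (chartField I V x₀ y) := by
  have hψ : MDifferentiableAt 𝓘(ℝ, E) I (extChartAt I x₀).symm y := by
    have := mdifferentiableWithinAt_extChartAt_symm (I := I) hy
    rwa [I.range_eq_univ, mdifferentiableWithinAt_univ] at this
  have h1 := mfderiv_comp_apply (I := 𝓘(ℝ, E)) (I' := I) (I'' := 𝓘(ℝ, F)) y hf hψ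
    (chartField I V x₀ y : E)
  rw [mfderiv_eq_fderiv] at h1
  have h2 := congrArg (fun L => L (V ((extChartAt I x₀).symm y)))
    (mfderivWithin_extChartAt_symm_comp_mfderiv_extChartAt (I := I) hy)
  rw [I.range_eq_univ, mfderivWithin_univ] at h2
  exact (congrArg (vderiv I f ((extChartAt I x₀).symm y)) h2).symm.trans h1.symm

theorem differentiableAt_chartField [IsManifold I 2 M] [CompleteSpace E] {V : M → E} {x₀ : M}
    (hV : MDifferentiableAt I I.tangent (fun x => (⟨x, V x⟩ : TangentBundle I M)) x₀) :
    DifferentiableAt ℝ (chartField I V x₀) (extChartAt I x₀ x₀) := by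
  have h := MDifferentiableWithinAt.differentiableWithinAt_mpullbackWithin_vectorField
    (s := Set.univ) hV.mdifferentiableWithinAt
  rw [Set.preimage_univ, Set.univ_inter, I.range_eq_univ] at h
  have h' := chartField_eventuallyEq I V x₀
  rw [I.range_eq_univ] at h'
  exact h'.differentiableAt_iff.1 (differentiableWithinAt_univ.1 h)

/-- The Jacobi–Lie bracket acts on functions as the commutator of Lie derivatives. -/
theorem lieDeriv_commutator [IsManifold I ∞ M] [CompleteSpace E] {f : M → F}
    (hf : ContMDiff I 𝓘(ℝ, F) ∞ f) {V W : M → E} (x₀ : M)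
    (hV : MDifferentiableAt I I.tangent (fun x => (⟨x, V x⟩ : TangentBundle I M)) x₀)
    (hW : MDifferentiableAt I I.tangent (fun x => (⟨x, W x⟩ : TangentBundle I M)) x₀)
    (hfV : MDifferentiableAt I 𝓘(ℝ, F) (fun x => vderiv I f x (V x)) x₀)
    (hfW : MDifferentiableAt I 𝓘(ℝ, F) (fun x => vderiv I f x (W x)) x₀) :
    vderiv I f x₀ (mlieBracket I V W x₀) =
      vderiv I (fun x => vderiv I f x (W x)) x₀ (V x₀) -
      vderiv I (fun x => vderiv I f x (V x)) x₀ (W x₀) := by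
  have : IsManifold I 2 M := IsManifold.of_le (n := ∞) (by norm_cast)
  set y₀ := extChartAt I x₀ x₀ with hy₀
  set g : E → F := f ∘ (extChartAt I x₀).symm with hg
  have hgc : ContDiffAt ℝ 2 g y₀ := by
    have h1 : ContMDiffAt 𝓘(ℝ, E) I 2 (extChartAt I x₀).symm y₀ :=
      (contMDiffOn_extChartAt_symm (n := 2) x₀).contMDiffAt (extChartAt_target_mem_nhds x₀)
    exact (((hf.of_le (by norm_cast)).contMDiffAt (n := 2)).comp y₀ h1).contDiffAt
  have hg' : DifferentiableAt ℝ (fderiv ℝ g) y₀ :=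
    (hgc.fderiv_right (m := 1) le_rfl).differentiableAt one_ne_zero
  have hsym : IsSymmSndFDerivAt ℝ g y₀ := hgc.isSymmSndFDerivAt (by simp)
  -- The product rule in the chart. The second-derivative term is symmetric in v and U x₀, so it
  -- cancels from the commutator.
  have key : ∀ {U : M → E},
      MDifferentiableAt I I.tangent (fun x => (⟨x, U x⟩ : TangentBundle I M)) x₀ →
      MDifferentiableAt I 𝓘(ℝ, F) (fun x => vderiv I f x (U x)) x₀ →
      ∀ v : E, vderiv I (fun x => vderiv I f x (U x)) x₀ v =
        fderiv ℝ g y₀ (fderiv ℝ (chartField I U x₀) y₀ v) + fderiv ℝ (fderiv ℝ g) y₀ v (U x₀) := by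
    intro U hU hfU v
    rw [vderiv_eq_fderiv_comp_symm I hfU]
    have h1 : (fun x => vderiv I f x (U x)) ∘ (extChartAt I x₀).symm =ᶠ[𝓝 y₀]
        fun y => fderiv ℝ g y (chartField I U x₀ y) := by
      filter_upwards [extChartAt_target_mem_nhds (I := I) x₀] with y hy
      exact vderiv_symm_apply I U x₀ hy (hf.mdifferentiable (by simp) _)
    rw [h1.fderiv_eq, fderiv_clm_apply hg' (differentiableAt_chartField I hU)]
    have h2 : chartField I U x₀ y₀ = U x₀ := chartField_self I U x₀
    simp [h2]
  rw [vderiv_eq_fderiv_comp_symm I (hf.mdifferentiable (by simp) _), key hV hfV, key hW hfW,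
    mlieBracket_eq_lieBracket_chartField, ← hy₀, lieBracket, map_sub,
    hsym (V x₀ : E) (W x₀ : E), hy₀, chartField_self, chartField_self]
  abel

end Chart

/-! ### Operator-valued functions -/

section ClmValued

variable {E : Type*} [NormedAddCommGroup E] [NormedSpace ℝ E]
  {H : Type*} [TopologicalSpace H] (I : ModelWithCorners ℝ E H)
  {M : Type*} [TopologicalSpace M] [ChartedSpace H M]
  {F : Type*} [NormedAddCommGroup F] [NormedSpace ℝ F]
  {D : Type*} [NormedAddCommGroup D] [NormedSpace ℝ D]

/-- Expanding in a finite basis of D writes T as a finite sum of fixed linear images of its values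
on basis vectors. -/
theorem contMDiff_clm_of_apply [FiniteDimensional ℝ D] {n : ℕ∞ω} {T : M → D →L[ℝ] F}
    (h : ∀ v, ContMDiff I 𝓘(ℝ, F) n fun x => T x v) :
    ContMDiff I 𝓘(ℝ, D →L[ℝ] F) n T := by
  let b := Module.finBasis ℝ D
  have hT : T = fun x => ∑ i, ContinuousLinearMap.smulRightL ℝ D F
      (LinearMap.toContinuousLinearMap (b.coord i)) (T x (b i)) := by
    ext x v
    have h1 := congrArg (T x) (b.sum_repr v)
    simp only [map_sum, map_smul] at h1
    simpa using h1.symm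
  rw [hT]
  exact contMDiff_finsetSum fun i _ => (ContinuousLinearMap.contMDiff _).comp (h (b i))

theorem vderiv_clm_apply [I.Boundaryless] {T : M → D →L[ℝ] F} {u : M → D} {x : M}
    (hT : MDifferentiableAt I 𝓘(ℝ, D →L[ℝ] F) T x) (hu : MDifferentiableAt I 𝓘(ℝ, D) u x) (v : E) :
    vderiv I (fun x => T x (u x)) x v = vderiv I T x v (u x) + T x (vderiv I u x v) := by
  have hc : MDifferentiableAt I 𝓘(ℝ, F) (fun x => T x (u x)) x := hT.clm_apply hu
  have h := fderiv_clm_apply (differentiableAt_comp_symm I hT) (differentiableAt_comp_symm I hu)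
  rw [vderiv_eq_fderiv_comp_symm I hc, vderiv_eq_fderiv_comp_symm I hT,
    vderiv_eq_fderiv_comp_symm I hu]
  refine (congrArg (fun L => L v) h).trans ?_
  simp [add_comm]

end ClmValued

/-! ### The group law in a chart and the sign of the bracket -/

section Group

variable {E : Type*} [NormedAddCommGroup E] [NormedSpace ℝ E]
  {H : Type*} [TopologicalSpace H] (I : ModelWithCorners ℝ E H)
  {G : Type*} [TopologicalSpace G] [ChartedSpace H G]
  {F : Type*} [NormedAddCommGroup F] [NormedSpace ℝ F]

theorem vderiv_comp_eq {f : G → G} {k : G → F} {a b : G} (hb : f a = b)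
    (hk : MDifferentiableAt I 𝓘(ℝ, F) k b) (hf : MDifferentiableAt I I f a) (v : E) :
    vderiv I k b (mfderiv I I f a v : E) = vderiv I (k ∘ f) a v := by
  subst hb
  exact (mfderiv_comp_apply (I := I) (I' := I) (I'' := 𝓘(ℝ, F)) a hk hf v).symm

theorem vderiv_clm_const_apply [I.Boundaryless] {D : Type*} [NormedAddCommGroup D] [NormedSpace ℝ D]
    (L : D →L[ℝ] F) {u : G → D} {x : G} (hu : MDifferentiableAt I 𝓘(ℝ, D) u x) (v : E) :
    vderiv I (fun x => L (u x)) x v = L (vderiv I u x v) := by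
  have h := vderiv_clm_apply I (T := fun _ => L) mdifferentiableAt_const hu v
  have h0 : vderiv I (fun _ : G => L) x = 0 := mfderiv_const
  rw [h, h0]
  simp

variable [Group G]

variable (G) in
/-- The group law in the chart at the identity. -/
noncomputable def chartMul (p : E × E) : E :=
  extChartAt I (1 : G) ((extChartAt I (1 : G)).symm p.1 * (extChartAt I (1 : G)).symm p.2)

/-- `T_e L_g` as a linear map on the model space. -/
noncomputable def dLeft (g : G) : E →L[ℝ] E := mfderiv I I (fun h : G => g * h) 1

/-- `T_e R_g` as a linear map on the model space. -/
noncomputable def dRight (g : G) : E →L[ℝ] E := mfderiv I I (fun h : G => h * g) 1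

theorem dLeft_one : dLeft I (1 : G) = .id ℝ E := by
  have h : (fun h : G => 1 * h) = id := funext one_mul
  unfold dLeft
  rw [h]
  exact mfderiv_id

theorem dRight_one : dRight I (1 : G) = .id ℝ E := by
  have h : (fun h : G => h * 1) = id := funext mul_one
  unfold dRight
  rw [h]
  exact mfderiv_id

variable [I.Boundaryless] [LieGroup I ∞ G]

theorem contDiffAt_chartMul :
    ContDiffAt ℝ 2 (chartMul I G) (extChartAt I (1 : G) 1, extChartAt I (1 : G) 1) := by
  have : IsManifold I 2 G := IsManifold.of_le (n := ∞) (by norm_cast)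
  have hψ : ContMDiffAt 𝓘(ℝ, E) I 2 (extChartAt I (1 : G)).symm (extChartAt I (1 : G) 1) :=
    (contMDiffOn_extChartAt_symm (n := 2) (1 : G)).contMDiffAt (extChartAt_target_mem_nhds 1)
  have h1 : ContMDiffAt 𝓘(ℝ, E × E) I 2 (fun p : E × E => (extChartAt I (1 : G)).symm p.1)
      (extChartAt I (1 : G) 1, extChartAt I (1 : G) 1) :=
    hψ.comp (extChartAt I (1 : G) 1, extChartAt I (1 : G) 1) contDiff_fst.contMDiff.contMDiffAt
  have h2 : ContMDiffAt 𝓘(ℝ, E × E) I 2 (fun p : E × E => (extChartAt I (1 : G)).symm p.2)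
      (extChartAt I (1 : G) 1, extChartAt I (1 : G) 1) :=
    hψ.comp (extChartAt I (1 : G) 1, extChartAt I (1 : G) 1) contDiff_snd.contMDiff.contMDiffAt
  have : LieGroup I 2 G := LieGroup.of_le (n := ∞) (by norm_cast)
  have h3 := h1.mul h2
  have h4 : ContMDiffAt I 𝓘(ℝ, E) 2 (extChartAt I (1 : G)) ((extChartAt I (1 : G)).symm
      (extChartAt I (1 : G) 1) * (extChartAt I (1 : G)).symm (extChartAt I (1 : G) 1)) := by
    rw [extChartAt_to_inv, one_mul]
    exact contMDiffAt_extChartAt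
  exact (ContMDiffAt.comp (extChartAt I (1 : G) 1, extChartAt I (1 : G) 1) h4 h3).contDiffAt

theorem differentiableAt_fderiv_chartMul : DifferentiableAt ℝ (fderiv ℝ (chartMul I G))
    (extChartAt I (1 : G) 1, extChartAt I (1 : G) 1) :=
  ((contDiffAt_chartMul I).fderiv_right (m := 1) le_rfl).differentiableAt one_ne_zero

theorem eventually_differentiableAt_chartMul :
    ∀ᶠ p in 𝓝 (extChartAt I (1 : G) 1, extChartAt I (1 : G) 1),
      DifferentiableAt ℝ (chartMul I G) p :=
  ((contDiffAt_chartMul I).eventually (by simp)).mono fun _ h => h.differentiableAt two_ne_zero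

/-- In the chart, right translation by the point with coordinate y is p ↦ `chartMul` (p, y); its
differential is the partial one in the first slot. The neighbourhood does not depend on x. -/
theorem chartField_dRight :
    ∀ᶠ y in 𝓝 (extChartAt I (1 : G) 1), ∀ x : G → E,
      chartField I (fun g : G => dRight I g (x g)) 1 y =
        fderiv ℝ (chartMul I G) (extChartAt I (1 : G) 1, y)
          (x ((extChartAt I (1 : G)).symm y), 0) := by
  have hc : ContinuousAt (fun y : E => (extChartAt I (1 : G) 1, y)) (extChartAt I (1 : G) 1) := by
    fun_prop
  have : IsManifold I 1 G := IsManifold.of_le (n := ∞) (by norm_cast)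
  filter_upwards [hc.eventually (eventually_differentiableAt_chartMul I (G := G)),
    extChartAt_target_mem_nhds (I := I) (1 : G)] with y hy hyt x
  set c := (extChartAt I (1 : G)).symm y with hcdef
  have hφ : MDifferentiableAt I 𝓘(ℝ, E) (extChartAt I (1 : G)) c :=
    mdifferentiableAt_extChartAt (by simpa [hcdef] using (extChartAt I (1 : G)).map_target hyt)
  have hφ' : MDifferentiableAt I 𝓘(ℝ, E) (extChartAt I (1 : G)) (1 * c) := by rwa [one_mul]
  have h1 := vderiv_comp_eq I (f := fun h : G => h * c) (one_mul c) hφ (mdiff_mulRight I c (1 : G)) (x c)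
  refine h1.trans ?_
  rw [vderiv_eq_fderiv_comp_symm I
    (MDifferentiableAt.comp (1 : G) (f := fun h : G => h * c) hφ' (mdiff_mulRight I c (1 : G)))]
  have h2 := hy.hasFDerivAt.comp (extChartAt I (1 : G) 1)
    (hasFDerivAt_prodMk_left (𝕜 := ℝ) (extChartAt I (1 : G) 1) y)
  exact congrArg (fun L => L (x c)) h2.fderiv

theorem chartField_dLeft :
    ∀ᶠ y in 𝓝 (extChartAt I (1 : G) 1), ∀ x : G → E,
      chartField I (fun g : G => dLeft I g (x g)) 1 y =
        fderiv ℝ (chartMul I G) (y, extChartAt I (1 : G) 1)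
          (0, x ((extChartAt I (1 : G)).symm y)) := by
  have hc : ContinuousAt (fun y : E => (y, extChartAt I (1 : G) 1)) (extChartAt I (1 : G) 1) := by
    fun_prop
  have : IsManifold I 1 G := IsManifold.of_le (n := ∞) (by norm_cast)
  filter_upwards [hc.eventually (eventually_differentiableAt_chartMul I (G := G)),
    extChartAt_target_mem_nhds (I := I) (1 : G)] with y hy hyt x
  set c := (extChartAt I (1 : G)).symm y with hcdef
  have hφ : MDifferentiableAt I 𝓘(ℝ, E) (extChartAt I (1 : G)) c :=
    mdifferentiableAt_extChartAt (by simpa [hcdef] using (extChartAt I (1 : G)).map_target hyt)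
  have hφ' : MDifferentiableAt I 𝓘(ℝ, E) (extChartAt I (1 : G)) (c * 1) := by rwa [mul_one]
  have h1 := vderiv_comp_eq I (mul_one c) hφ (mdiff_mulLeft I c (1 : G)) (x c)
  refine h1.trans ?_
  rw [vderiv_eq_fderiv_comp_symm I
    (MDifferentiableAt.comp (1 : G) (f := fun h : G => c * h) hφ' (mdiff_mulLeft I c (1 : G)))]
  have h2 := hy.hasFDerivAt.comp (extChartAt I (1 : G) 1)
    (hasFDerivAt_prodMk_right (𝕜 := ℝ) y (extChartAt I (1 : G) 1))
  exact congrArg (fun L => L (x c)) h2.fderiv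

/-- The derivative at the identity of a field `g ↦ T_e R_g (x(g))` in the chart. -/
theorem fderiv_chartField_dRight {x : G → E} (hx : MDifferentiableAt I 𝓘(ℝ, E) x 1) (v : E) :
    fderiv ℝ (chartField I (fun g : G => dRight I g (x g)) 1) (extChartAt I (1 : G) 1) v =
      fderiv ℝ (fderiv ℝ (chartMul I G)) (extChartAt I (1 : G) 1, extChartAt I (1 : G) 1)
        (0, v) (x 1, 0) + vderiv I x 1 v := by
  have : IsManifold I 1 G := IsManifold.of_le (n := ∞) (by norm_cast)
  set y₀ := extChartAt I (1 : G) 1 with hy₀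
  have h1 := (chartField_dRight I (G := G)).mono fun y hy => hy x
  have h2 := (differentiableAt_fderiv_chartMul I (G := G)).hasFDerivAt.comp y₀
    (hasFDerivAt_prodMk_right (𝕜 := ℝ) y₀ y₀)
  have h3 := (differentiableAt_comp_symm I hx).hasFDerivAt
  have h4 := h3.prodMk (hasFDerivAt_const (0 : E) y₀)
  have h5 := h2.clm_apply h4
  -- The unit law, differentiated: T_eR_e is the identity, so the derivative of x enters with
  -- coefficient one.
  have h6 : ∀ u : E, fderiv ℝ (chartMul I G) (y₀, y₀) (u, 0) = u := fun u => by
    have h := (chartField_dRight I (G := G)).self_of_nhds fun _ => u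
    rw [chartField_self, dRight_one] at h
    exact h.symm
  rw [EventuallyEq.fderiv_eq h1]
  refine (congrArg (fun L => L v) h5.fderiv).trans ?_
  rw [vderiv_eq_fderiv_comp_symm I hx, ← hy₀]
  have h7 : (extChartAt I (1 : G)).symm y₀ = 1 := extChartAt_to_inv 1
  have h8 : (x ∘ (extChartAt I (1 : G)).symm) y₀ = x 1 := congrArg x h7
  rw [h8]
  simp [h6, add_comm]

theorem fderiv_chartField_dLeft (w v : E) :
    fderiv ℝ (chartField I (fun g : G => dLeft I g w) 1) (extChartAt I (1 : G) 1) v =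
      fderiv ℝ (fderiv ℝ (chartMul I G)) (extChartAt I (1 : G) 1, extChartAt I (1 : G) 1)
        (v, 0) (0, w) := by
  set y₀ := extChartAt I (1 : G) 1 with hy₀
  have h1 := (chartField_dLeft I (G := G)).mono fun y hy => hy fun _ => w
  have h2 := HasFDerivAt.comp y₀ (f := fun y : E => (y, y₀))
    (differentiableAt_fderiv_chartMul I (G := G)).hasFDerivAt
    (hasFDerivAt_prodMk_left (𝕜 := ℝ) y₀ y₀)
  have h5 := h2.clm_apply (hasFDerivAt_const ((0 : E), w) y₀)
  rw [EventuallyEq.fderiv_eq h1]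
  refine (congrArg (fun L => L v) h5.fderiv).trans ?_
  simp [hy₀]

/-- Both sides are the mixed second derivative of multiplication at (e, e), with v in the second
slot and w in the first; only the order of differentiation differs. -/
theorem fderiv_chartField_swap (v w : E) :
    fderiv ℝ (chartField I (fun g : G => dRight I g w) 1) (extChartAt I (1 : G) 1) v =
      fderiv ℝ (chartField I (fun g : G => dLeft I g v) 1) (extChartAt I (1 : G) 1) w := by
  rw [fderiv_chartField_dLeft,
    fderiv_chartField_dRight I (x := fun _ : G => w) mdifferentiableAt_const,
    (contDiffAt_chartMul I).isSymmSndFDerivAt (by simp) (0, v) (w, 0)]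
  have h0 : vderiv I (fun _ : G => w) 1 = 0 := mfderiv_const
  simp [h0]

theorem groupBracket_eq_fderiv (v w : GroupLieAlgebra I G) :
    (⁅v, w⁆ : GroupLieAlgebra I G) =
      (fderiv ℝ (chartField I (fun g : G => dLeft I g w) 1) (extChartAt I (1 : G) 1) v -
      fderiv ℝ (chartField I (fun g : G => dLeft I g v) 1) (extChartAt I (1 : G) 1) w : E) := by
  have : IsManifold I 1 G := IsManifold.of_le (n := ∞) (by norm_cast)
  refine (mlieBracket_eq_lieBracket_chartField I (fun g : G => dLeft I g v)
    (fun g : G => dLeft I g w) 1).trans ?_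
  rw [lieBracket, chartField_self, chartField_self, dLeft_one]
  rfl

/-- The swap turns each term of the right-invariant bracket into the opposite term of the
left-invariant one. -/
theorem rightBracket_eq_neg (v w : GroupLieAlgebra I G) : rightBracket I v w = -⁅v, w⁆ := by
  have : IsManifold I 1 G := IsManifold.of_le (n := ∞) (by norm_cast)
  refine (mlieBracket_eq_lieBracket_chartField I (fun g : G => dRight I g v)
    (fun g : G => dRight I g w) 1).trans ?_
  refine Eq.trans ?_ (congrArg (fun u : E => -u) (groupBracket_eq_fderiv I v w)).symm
  rw [lieBracket, chartField_self, chartField_self, dRight_one, neg_sub]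
  exact congrArg₂ (· - ·) (fderiv_chartField_swap I v w) (fderiv_chartField_swap I w v)

end Group

/-! ### The adjoint representation and its differential -/

section Adjoint

variable {E : Type*} [NormedAddCommGroup E] [NormedSpace ℝ E]
  {H : Type*} [TopologicalSpace H] (I : ModelWithCorners ℝ E H)
  {G : Type*} [TopologicalSpace G] [ChartedSpace H G] [Group G]

/-- The adjoint representation. -/
noncomputable def adjoint (g : G) : E →L[ℝ] E := mfderiv I I (fun h : G => (g * h) * g⁻¹) 1

theorem adjoint_one : adjoint I (1 : G) = .id ℝ E := by
  have h : (fun h : G => (1 * h) * 1⁻¹) = id := by ext; simp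
  unfold adjoint
  rw [h]
  exact mfderiv_id

variable [LieGroup I ∞ G]

theorem adjoint_mul (g h : G) (v : E) : adjoint I (g * h) v = adjoint I g (adjoint I h v) := by
  have hc (a b : G) : MDifferentiableAt I I (fun h : G => (a * h) * a⁻¹) b :=
    (mdiff_mulRight I a⁻¹ (a * b)).comp b (mdiff_mulLeft I a b)
  have h1 := mfderiv_comp_eq I (f := fun k : G => (h * k) * h⁻¹) (k := fun k : G => (g * k) * g⁻¹)
    (a := 1) (b := 1) (by simp) (hc g 1) (hc h 1) v
  refine Eq.trans ?_ h1.symm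
  have h2 : (fun k : G => (g * k) * g⁻¹) ∘ (fun k : G => (h * k) * h⁻¹) =
      fun k : G => ((g * h) * k) * (g * h)⁻¹ := by
    ext k; simp [mul_assoc]
  rw [h2]
  rfl

theorem adjoint_inv_adjoint (g : G) (v : E) : adjoint I g⁻¹ (adjoint I g v) = v := by
  rw [← adjoint_mul, inv_mul_cancel, adjoint_one]
  rfl

theorem rightMC_dLeft (g : G) (v : E) : rightMC I g (dLeft I g v) = adjoint I g v :=
  rightMC_tangentLeft I g v

theorem leftMC_dRight (g : G) (v : E) : leftMC I g (dRight I g v) = adjoint I g⁻¹ v := by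
  refine (leftMC_tangentRight I g v).trans ?_
  have h : (fun h : G => g⁻¹ * (h * g)) = fun h : G => (g⁻¹ * h) * g⁻¹⁻¹ := by
    ext h; simp [mul_assoc]
  rw [h]
  rfl

/-- This exhibits a left-invariant field as a right-trivialized one with coefficient Ad_g v, which
is how Ad gets differentiated. -/
theorem dRight_adjoint (g : G) (v : E) : dRight I g (adjoint I g v) = dLeft I g v :=
  (congrArg (dRight I g) (rightMC_dLeft I g v)).symm.trans
    (tangentRight_rightMC I g (dLeft I g v))

theorem contMDiff_adjoint [FiniteDimensional ℝ E] :
    ContMDiff I 𝓘(ℝ, E →L[ℝ] E) ∞ (adjoint I : G → E →L[ℝ] E) :=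
  contMDiff_clm_of_apply I fun v =>
    (contMDiff_rightMC_tangentLeft I (x := fun _ : G => v) contMDiff_const).congr
      fun g => (rightMC_dLeft I g v).symm

variable (G) in
/-- The bracket of left-invariant vector fields as a continuous bilinear map. -/
noncomputable def leftBracket [FiniteDimensional ℝ E] : E →L[ℝ] E →L[ℝ] E :=
  have : CompleteSpace E := FiniteDimensional.complete ℝ E;
  -(LinearMap.toContinuousLinearMap.toLinearMap ∘ₗ rightBracketBilin I G).toContinuousLinearMap

variable [I.Boundaryless]

theorem leftBracket_apply [FiniteDimensional ℝ E] (v w : GroupLieAlgebra I G) :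
    leftBracket I G v w = ⁅v, w⁆ :=
  (congrArg (fun u : E => -u) (rightBracket_eq_neg I v w)).trans (neg_neg _)

/-- The differential of the adjoint representation is the bracket. -/
theorem vderiv_adjoint_one [FiniteDimensional ℝ E] (v w : E) :
    vderiv I (adjoint I : G → E →L[ℝ] E) 1 v w =
      leftBracket I G v w := by
  have hA := (contMDiff_adjoint I (G := G)).mdifferentiable (by simp) 1
  have h0 : vderiv I (fun _ : G => w) 1 = 0 := mfderiv_const
  have h1 := vderiv_clm_apply I hA (mdifferentiableAt_const (c := w)) v
  rw [h0] at h1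
  -- The field T_eR_g(Ad_g w) is the left-invariant field of w. Its chart derivative is therefore
  -- that of the right-invariant field of w plus d Ad(v) w.
  have h2 := fderiv_chartField_dRight I
    (hA.clm_apply (mdifferentiableAt_const (c := w))) v
  simp only [dRight_adjoint, h1, adjoint_one] at h2
  have h3 := fderiv_chartField_dRight I (x := fun _ : G => w) mdifferentiableAt_const v
  rw [h0] at h3
  have h4 := fderiv_chartField_swap I (G := G) v w
  rw [(leftBracket_apply I (G := G) v w).trans (groupBracket_eq_fderiv I (G := G) v w)]
  rw [h2, ← h4, h3]
  simp

/-- Since Ad_{gh} = Ad_g Ad_h, the derivative at g is Ad_g composed with the derivative at the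
identity. -/
theorem vderiv_adjoint [FiniteDimensional ℝ E] (g : G) (v w : E) :
    vderiv I (adjoint I : G → E →L[ℝ] E) g (dLeft I g v) w =
      adjoint I g (leftBracket I G v w) := by
  have hA := (contMDiff_adjoint I (G := G)).mdifferentiable (by simp)
  have h1 := vderiv_comp_eq I (f := fun h : G => g * h) (mul_one g) (hA g) (mdiff_mulLeft I g 1) v
  have h2 : (adjoint I : G → E →L[ℝ] E) ∘ (fun h : G => g * h) =
      fun h => ContinuousLinearMap.compL ℝ E E E (adjoint I g) (adjoint I h) := by
    ext h u
    exact adjoint_mul I g h u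
  rw [h2, vderiv_clm_const_apply I _ (hA 1)] at h1
  refine (congrArg (fun L : E →L[ℝ] E => L w) h1).trans ?_
  exact congrArg (adjoint I g) (vderiv_adjoint_one I v w)

end Adjoint

/-! ### The two connections and the post-Lie identities -/

section Connection

variable {E : Type*} [NormedAddCommGroup E] [NormedSpace ℝ E]
  {H : Type*} [TopologicalSpace H] (I : ModelWithCorners ℝ E H)
  {G : Type*} [TopologicalSpace G] [ChartedSpace H G] [Group G]

/-- The differential of `z` in the left trivialization. -/
noncomputable def trivDeriv (z : G → E) (g : G) : E →L[ℝ] E := (vderiv I z g).comp (dLeft I g)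

variable [LieGroup I ∞ G]

theorem leftConn_apply (y z : Omega0 I G) (g : G) :
    leftConn I y z g = trivDeriv I z g (y g) := rfl

variable [FiniteDimensional ℝ E]

theorem bracket_apply (x y : Omega0 I G) (g : G) : bracket I x y g =
    -leftBracket I G (x g) (y g) :=
  (neg_neg _).symm

/-- Evaluating on a constant vector v gives v ▷̃ z, which is already smooth. -/
theorem contMDiff_trivDeriv (z : Omega0 I G) :
    ContMDiff I 𝓘(ℝ, E →L[ℝ] E) ∞ (trivDeriv I z : G → E →L[ℝ] E) :=
  contMDiff_clm_of_apply I fun v => (leftConn I (⟨fun _ => v, contMDiff_const⟩) z).contMDiff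

theorem neg_bracket_apply (x y : Omega0 I G) (g : G) : (-bracket I x y) g =
    leftBracket I G (x g) (y g) :=
  (congrArg (fun u : E => -u) (bracket_apply I x y g)).trans (neg_neg _)

variable [I.Boundaryless]

theorem leftConn_eq (x y : Omega0 I G) : leftConn I x y =
    rightToLeft I G (rightConn I ((rightToLeft I G).symm x) ((rightToLeft I G).symm y)) +
      bracket I x y := by
  ext g
  have hA := (contMDiff_adjoint I (G := G)).mdifferentiable (by simp) g
  have hy : MDifferentiableAt I 𝓘(ℝ, E) y g := y.contMDiff.mdifferentiable (by simp) g
  have hs (z : Omega0 I G) (h : G) : (rightToLeft I G).symm z h = adjoint I h (z h) :=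
    rightMC_dLeft I h (z h)
  -- Both trivializations of x describe one vector field, so only the differentiated function
  -- changes, from y to Ad y.
  have h1 : rightConn I ((rightToLeft I G).symm x) ((rightToLeft I G).symm y) g =
      vderiv I (fun h => adjoint I h (y h)) g (dLeft I g (x g)) := by
    have e1 : ((rightToLeft I G).symm y : G → E) = fun h => adjoint I h (y h) := funext (hs y)
    have e2 : dRight I g ((rightToLeft I G).symm x g) = dLeft I g (x g) := by
      rw [hs, dRight_adjoint]
    exact congrArg₂ (fun f u => vderiv I f g u) e1 e2
  rw [vderiv_clm_apply I hA hy, vderiv_adjoint] at h1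
  have h2 : rightToLeft I G
      (rightConn I ((rightToLeft I G).symm x) ((rightToLeft I G).symm y)) g =
      adjoint I g⁻¹ (rightConn I ((rightToLeft I G).symm x) ((rightToLeft I G).symm y) g) :=
    leftMC_dRight I g _
  rw [ContMDiffMap.coe_add, Pi.add_apply, h2, h1, map_add, adjoint_inv_adjoint,
    adjoint_inv_adjoint, bracket_apply]
  have h3 : leftConn I x y g = vderiv I y g (dLeft I g (x g)) := rfl
  rw [h3]
  abel

/-- The Leibniz term that differentiates y is exactly (x ▷̃ y) ▷̃ z, and it cancels. -/
theorem associator_apply (x y z : Omega0 I G) (g : G) :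
    (leftConn I x (leftConn I y z) - leftConn I (leftConn I x y) z) g =
      vderiv I (trivDeriv I z) g (dLeft I g (x g)) (y g) := by
  have hT := (contMDiff_trivDeriv I z).mdifferentiable (by simp) g
  have hy : MDifferentiableAt I 𝓘(ℝ, E) y g := y.contMDiff.mdifferentiable (by simp) g
  have h := vderiv_clm_apply I hT hy (dLeft I g (x g))
  have h1 : leftConn I x (leftConn I y z) g =
      vderiv I (fun h => trivDeriv I z h (y h)) g (dLeft I g (x g)) := rfl
  have h2 : leftConn I (leftConn I x y) z g =
      trivDeriv I z g (vderiv I y g (dLeft I g (x g))) := rfl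
  rw [ContMDiffMap.coe_sub, Pi.sub_apply, h1, h, h2]
  abel

theorem vderiv_trivDeriv_sub (z : Omega0 I G) (g : G) (v w : E) :
    vderiv I (trivDeriv I z) g (dLeft I g v) w - vderiv I (trivDeriv I z) g (dLeft I g w) v =
      trivDeriv I z g
        (leftBracket I G v w) := by
  have : IsManifold I 1 G := IsManifold.of_le (n := ∞) (by norm_cast)
  have : CompleteSpace E := FiniteDimensional.complete ℝ E
  have : LieGroup I (minSmoothness ℝ 3) G := LieGroup.of_le (n := ∞) (by simp; norm_cast)
  have hT := (contMDiff_trivDeriv I z).mdifferentiable (by simp) g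
  have hL (u : E) : MDifferentiableAt I I.tangent
      (fun h => (⟨h, dLeft I h u⟩ : TangentBundle I G)) g :=
    (contMDiff_tangentLeft I (x := fun _ => u) contMDiff_const).mdifferentiable (by simp) g
  have hc (u : E) : MDifferentiableAt I 𝓘(ℝ, E) (fun h => trivDeriv I z h u) g :=
    hT.clm_apply mdifferentiableAt_const
  -- For left-invariant fields the antisymmetrized derivative of Dz is the commutator of Lie
  -- derivatives on z; their Jacobi–Lie bracket is again left-invariant.
  have key := lieDeriv_commutator I z.contMDiff (V := fun h => dLeft I h v)
    (W := fun h => dLeft I h w) g (hL v) (hL w) (hc v) (hc w)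
  have hd (u u' : E) : vderiv I (fun h => trivDeriv I z h u) g u' =
      vderiv I (trivDeriv I z) g u' u := by
    have h0 : vderiv I (fun _ : G => u) g = 0 := mfderiv_const
    have h := vderiv_clm_apply I hT (mdifferentiableAt_const (c := u)) u'
    rw [h0] at h
    simpa using h
  have hb := congrFun (mulInvariantVector_mlieBracket (I := I) (G := G) v w) g
  have hb' : (mlieBracket I (fun h => dLeft I h v) (fun h => dLeft I h w) g : E) =
      dLeft I g (leftBracket I G v w) :=
    hb.symm.trans (congrArg (dLeft I g) (leftBracket_apply I v w)).symm
  rw [← hd, ← hd]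
  exact key.symm.trans (congrArg (vderiv I z g) hb')

theorem isPostLieAlgebra_leftConn : IsPostLieAlgebra ℝ (A := Omega0 I G)
    (fun x y => -bracket I x y) (leftConn I) := by
  have : CompleteSpace E := FiniteDimensional.complete ℝ E
  have : LieGroup I (minSmoothness ℝ 3) G := LieGroup.of_le (n := ∞) (by simp; norm_cast)
  have hd (x : Omega0 I G) (g : G) : MDifferentiableAt I 𝓘(ℝ, E) x g :=
    x.contMDiff.mdifferentiable (by simp) g
  constructor
  · intro x y z
    ext g
    simp only [neg_bracket_apply, ContMDiffMap.coe_add, Pi.add_apply, map_add,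
      add_apply]
  · intro c x y
    ext g
    simp only [neg_bracket_apply, ContMDiffMap.coe_smul, Pi.smul_apply, map_smul,
      smul_apply]
  · intro x y z
    ext g
    simp only [neg_bracket_apply, ContMDiffMap.coe_add, Pi.add_apply, map_add]
  · intro c x y
    ext g
    simp only [neg_bracket_apply, ContMDiffMap.coe_smul, Pi.smul_apply, map_smul]
  · intro x
    ext g
    rw [neg_bracket_apply]
    exact (leftBracket_apply I (x g) (x g)).trans (lie_self (L := GroupLieAlgebra I G) (x g))
  · intro x y z
    ext g
    have h (u v w : GroupLieAlgebra I G) : ⁅⁅u, v⁆, w⁆ + ⁅⁅v, w⁆, u⁆ + ⁅⁅w, u⁆, v⁆ = 0 := by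
      -- Skew-symmetry moves the outer brackets into the right-nested form of `lie_jacobi`.
      rw [← lie_skew ⁅u, v⁆ w, ← lie_skew ⁅v, w⁆ u, ← lie_skew ⁅w, u⁆ v, ← neg_add, ← neg_add, neg_eq_zero,
        ← lie_jacobi u v w]
      abel
    have e (u v w : GroupLieAlgebra I G) : leftBracket I G (leftBracket I G u v) w = ⁅⁅u, v⁆, w⁆ :=
      (leftBracket_apply I _ w).trans
        (congrArg (fun t : GroupLieAlgebra I G => ⁅t, w⁆) (leftBracket_apply I u v))
    simp only [ContMDiffMap.coe_add, Pi.add_apply, neg_bracket_apply]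
    exact (congrArg₂ (fun a b : E => a + b) (congrArg₂ (fun a b : E => a + b)
      (e (x g) (y g) (z g)) (e (y g) (z g) (x g))) (e (z g) (x g) (y g))).trans
      (h (x g) (y g) (z g))
  · intro x y z
    ext g
    exact map_add (trivDeriv I z g) (x g) (y g)
  · intro c x z
    ext g
    exact map_smul (trivDeriv I z g) c (x g)
  · intro x y z
    ext g
    have h : vderiv I (y + z) g = vderiv I y g + vderiv I z g := mfderiv_add (hd y g) (hd z g)
    exact congrArg (fun L : E →L[ℝ] E => L (dLeft I g (x g))) h
  · intro c x y
    ext g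
    exact vderiv_clm_const_apply I (c • ContinuousLinearMap.id ℝ E) (hd y g) (dLeft I g (x g))
  · intro x y z
    ext g
    -- The bracket is constant in g, so only y and z are differentiated.
    have h := vderiv_clm_apply I (((leftBracket I G).mdifferentiableAt).comp g (hd y g)) (hd z g)
      (dLeft I g (x g))
    have h1 := vderiv_clm_const_apply I (leftBracket I G) (hd y g) (dLeft I g (x g))
    have h2 : leftConn I x (-bracket I y z) g =
        vderiv I (fun h => leftBracket I G (y h) (z h)) g (dLeft I g (x g)) :=
      congrArg (fun f => vderiv I f g (dLeft I g (x g))) (funext (neg_bracket_apply I y z))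
    rw [ContMDiffMap.coe_add, Pi.add_apply, neg_bracket_apply, neg_bracket_apply, h2]
    exact h.trans (congrArg (fun L : E →L[ℝ] E => L (z g) + _) h1)
  · intro x y z
    ext g
    rw [ContMDiffMap.coe_sub, Pi.sub_apply, associator_apply, associator_apply,
      vderiv_trivDeriv_sub, leftConn_apply, neg_bracket_apply]

end Connection

end LieFun

theorem mainTheorem7 {E : Type*} [NormedAddCommGroup E] [NormedSpace ℝ E] [FiniteDimensional ℝ E]
    {H : Type*} [TopologicalSpace H] (I : ModelWithCorners ℝ E H) [I.Boundaryless]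
    (G : Type*) [TopologicalSpace G] [ChartedSpace H G] [Group G] [LieGroup I ∞ G] :
    -- `{Ω⁰(G, 𝔤), -[·,·], ▷̃}` is a post-Lie algebra
    IsPostLieAlgebra ℝ (A := LieFun.Omega0 I G)
      (fun x y => -LieFun.bracket I x y) (LieFun.leftConn I) ∧
    -- `x ▷̃ y = x ▷ y + [x,y]`, where `▷` is transported to the left trivialization
    (∀ x y : LieFun.Omega0 I G,
      LieFun.leftConn I x y =
        LieFun.rightToLeft I G (LieFun.rightConn I
          ((LieFun.rightToLeft I G).symm x) ((LieFun.rightToLeft I G).symm y)) +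
        LieFun.bracket I x y) ∧
    -- the bracket of `𝔤` used here is the negative of the one from left-invariant vector fields
    (∀ v w : GroupLieAlgebra I G, LieFun.rightBracket I v w = -⁅v, w⁆) :=
  ⟨LieFun.isPostLieAlgebra_leftConn I, LieFun.leftConn_eq I, LieFun.rightBracket_eq_neg I⟩
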